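/- Let $k$ be a $\mathbb Z$-graded commutative ring ($ab=(-1)^{ij}ba$ for $a\in k^i$, $b\in k^j$), regarded as a dg ring with zero differential. Let $\mathrm{dg}$ be the category of differential $\mathbb Z$-graded $k$-modules: graded left $k$-modules $M=(M^i)_{i\in\mathbb Z}$ with a differential $d:M^i\to M^{i+1}$, $d^2=0$, which is $k$-linear in the sense that, with operators written on the right, $(am)d=a(md)$; its morphisms are the $k$-linear chain maps of degree $0$. The shift is given by $M[p]^z=M^{z+p}$ with differential $(-1)^pd$. The cone of $\alpha:M\to N$ is $\mathrm{Cone}(\alpha)=M[1]\oplus N$ with differential $(m,n)\mapsto(-md,\;m\alpha+nd)$. A quasi-isomorphism is a morphism inducing isomorphisms in cohomology. Let $S$ be a set and let $\mathrm{dg}^S$ be the category of families $(M(x))_{x\in S}$ of objects of $\mathrm{dg}$; shifts, quasi-isomorphisms and degreewise surjections in $\mathrm{dg}^S$ are understood componentwise. For $x\in S$ let $K_x\in\mathrm{dg}^S$ be given by $K_x(x)=\mathrm{Cone}(\mathrm{id}_k)$ and $K_x(y)=0$ for $y\ne x$. **Theorem.** Let $\mathcal C$ be a complete and cocomplete (locally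 small) category and let $F:\mathrm{dg}^S\rightleftarrows\mathcal C:U$ be an adjunction, with $F$ left adjoint to $U$. Assume that $U$ preserves filtered colimits and that for every object $A$ of $\mathcal C$, every $x\in S$ and every $p\in\mathbb Z$ the morphism $U(\mathrm{inj}_2):UA\to U(F(K_x[p])\sqcup A)$ is a quasi-isomorphism. Then $\mathcal C$ is a model category, with functorial factorizations, in which 1. the weak equivalences are the morphisms $f$ such that $Uf$ is a quasi-isomorphism; 2. the fibrations are the morphisms $f$ such that $Uf$ is surjective in each degree at each $x\in S$ (equivalently, an epimorphism in $\mathrm{dg}^S$); 3. the cofibrations are the morphisms with the left lifting property with respect to all morphisms that are both weak equivalences and fibrations. In detail: $\mathcal C$ has all limits and colimits; weak equivalences have the two-out-of-three property; the three classes are closed under retracts; cofibrations lift against trivial fibrations and trivial cofibrations lift against fibrations; and every morphism factors, functorially, both as a trivial cofibration followed by a fibration and as a cofibration followed by a trivial fibration. -/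

import Mathlib

open CategoryTheory Limits HomotopicalAlgebra

universe v u

/-- A `ℤ`-graded ring is graded commutative if `a * b = (-1)^(i j) b * a` for all homogeneous
elements `a`, `b` of degrees `i`, `j`. -/
def IsGradedCommutative {R : Type v} [Ring R] (𝒜 : ℤ → AddSubgroup R) : Prop :=
  ∀ (i j : ℤ) (a b : R), a ∈ 𝒜 i → b ∈ 𝒜 j → a * b = (i * j).negOnePow • (b * a)

/-- A differential `ℤ`-graded (left) module over the graded ring `𝒜` (with zero differential).
The differential has degree `1`. Operators are written on the right of their arguments, so that
a `𝒜`-linear differential satisfies `(a x) d = a (x d)`, without a sign. (Replacing `d` by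
`(-1)^|x| d x` gives an isomorphism with the category in which `d (a x) = (-1)^|a| a (d x)`.)

In order to avoid transport along equalities of degrees, the action and the differential take
the equality of degrees as an argument. -/
structure DGModule {R : Type v} [Ring R] (𝒜 : ℤ → AddSubgroup R) [GradedRing 𝒜] where
  /-- the homogeneous components -/
  X : ℤ → Type v
  [grp : ∀ i, AddCommGroup (X i)]
  /-- the action of homogeneous scalars -/
  smul : ∀ {i j n : ℤ}, i + j = n → (𝒜 i →+ X j →+ X n)
  one_smul : ∀ {i : ℤ} (x : X i),
    smul (zero_add i) ⟨1, SetLike.GradedOne.one_mem⟩ x = x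
  mul_smul : ∀ {i j l m n : ℤ} (hm : j + l = m) (hn : i + m = n) (hn' : (i + j) + l = n)
    (a : 𝒜 i) (b : 𝒜 j) (x : X l),
    smul hn' ⟨a.1 * b.1, SetLike.GradedMul.mul_mem a.2 b.2⟩ x = smul hn a (smul hm b x)
  /-- the differential -/
  d : ∀ {i j : ℤ}, i + 1 = j → (X i →+ X j)
  d_d : ∀ {i j l : ℤ} (hj : i + 1 = j) (hl : j + 1 = l) (x : X i), d hl (d hj x) = 0
  d_smul : ∀ {i j n j' n' : ℤ} (hn : i + j = n) (hj' : j + 1 = j') (hn' : n + 1 = n')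
    (h : i + j' = n') (a : 𝒜 i) (x : X j),
    d hn' (smul hn a x) = smul h a (d hj' x)

namespace DGModule

attribute [instance] DGModule.grp

section

variable {R : Type v} [Ring R] {𝒜 : ℤ → AddSubgroup R} [GradedRing 𝒜]

/-- Chain maps that are `𝒜`-linear of degree `0`. -/
@[ext]
structure Hom (M N : DGModule 𝒜) where
  /-- the homogeneous components -/
  f : ∀ i : ℤ, M.X i →+ N.X i
  map_smul : ∀ {i j n : ℤ} (hn : i + j = n) (a : 𝒜 i) (x : M.X j),
    f n (M.smul hn a x) = N.smul hn a (f j x)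
  map_d : ∀ {i j : ℤ} (hj : i + 1 = j) (x : M.X i), f j (M.d hj x) = N.d hj (f i x)

instance category : Category.{v} (DGModule 𝒜) where
  Hom M N := Hom M N
  id M := { f := fun i => AddMonoidHom.id _, map_smul := fun _ _ _ => rfl, map_d := fun _ _ => rfl }
  comp φ ψ :=
    { f := fun i => (ψ.f i).comp (φ.f i)
      map_smul := fun hn a x => by simp [φ.map_smul, ψ.map_smul]
      map_d := fun hj x => by simp [φ.map_d, ψ.map_d] }

@[simp] lemma id_f (M : DGModule 𝒜) (i : ℤ) : Hom.f (𝟙 M) i = AddMonoidHom.id _ := rfl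

@[simp] lemma comp_f {M N P : DGModule 𝒜} (φ : M ⟶ N) (ψ : N ⟶ P) (i : ℤ) :
    Hom.f (φ ≫ ψ) i = (Hom.f ψ i).comp (Hom.f φ i) := rfl

/-- The underlying cochain complex of abelian groups of a differential graded module. -/
noncomputable def toCochainComplex (𝒜 : ℤ → AddSubgroup R) [GradedRing 𝒜] :
    DGModule 𝒜 ⥤ CochainComplex AddCommGrpCat.{v} ℤ where
  obj M :=
    { X := fun i => AddCommGrpCat.of (M.X i)
      d := fun i j => if h : i + 1 = j then AddCommGrpCat.ofHom (M.d h) else 0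
      shape := fun i j h => dif_neg h
      d_comp_d' := fun i j l hj hl => by
        have hj' : i + 1 = j := hj
        have hl' : j + 1 = l := hl
        rw [dif_pos hj', dif_pos hl']
        ext x
        exact M.d_d hj' hl' x }
  map φ :=
    { f := fun i => AddCommGrpCat.ofHom (Hom.f φ i)
      comm' := fun i j hj => by
        have hj' : i + 1 = j := hj
        dsimp only
        rw [dif_pos hj', dif_pos hj']
        ext x
        exact (Hom.map_d φ hj' x).symm }

/-- A quasi-isomorphism: a morphism which induces isomorphisms in cohomology. -/
def IsQuasiIso {M N : DGModule 𝒜} (φ : M ⟶ N) : Prop :=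
  QuasiIso ((toCochainComplex 𝒜).map φ)

/-- A morphism which is surjective in each degree. -/
def IsSurjective {M N : DGModule 𝒜} (φ : M ⟶ N) : Prop :=
  ∀ i : ℤ, Function.Surjective (Hom.f φ i)

/-- The zero module. -/
def zero (𝒜 : ℤ → AddSubgroup R) [GradedRing 𝒜] : DGModule 𝒜 where
  X _ := PUnit
  smul _ := 0
  one_smul _ := rfl
  mul_smul _ _ _ _ _ _ := rfl
  d _ := 0
  d_d _ _ _ := rfl
  d_smul _ _ _ _ _ _ := rfl

/-- The graded ring, as a module over itself with zero differential. -/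
def unit (𝒜 : ℤ → AddSubgroup R) [GradedRing 𝒜] : DGModule 𝒜 where
  X i := 𝒜 i
  smul h := AddMonoidHom.mk'
    (fun a => AddMonoidHom.mk'
      (fun x => ⟨a.1 * x.1, h ▸ SetLike.GradedMul.mul_mem a.2 x.2⟩)
      (fun x y => Subtype.ext (mul_add a.1 x.1 y.1)))
    (fun a b => AddMonoidHom.ext fun x => Subtype.ext (add_mul a.1 b.1 x.1))
  one_smul x := Subtype.ext (one_mul x.1)
  mul_smul _ _ _ a b x := Subtype.ext (mul_assoc a.1 b.1 x.1)
  d _ := 0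
  d_d _ _ _ := rfl
  d_smul _ _ _ _ _ _ := (map_zero _).symm

/-- The shift `M[p]`: one has `M[p]^z = M^(z+p)`, the differential is multiplied by `(-1)^p`, and
the action of scalars is unchanged. -/
def shift (M : DGModule 𝒜) (p : ℤ) : DGModule 𝒜 where
  X i := M.X (i + p)
  smul {i j n} h := M.smul (show i + (j + p) = n + p by omega)
  one_smul {i} x := by
    have key : ∀ (m : ℤ) (h : 0 + (i + p) = m) (hm : m = i + p),
        HEq (M.smul h ⟨1, SetLike.GradedOne.one_mem⟩ x) x := by
      intro m h hm
      subst hm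
      exact heq_of_eq (M.one_smul x)
    exact eq_of_heq (key _ _ rfl)
  mul_smul hm hn hn' a b x := M.mul_smul _ _ (by omega) a b x
  d {i j} h := p.negOnePow • M.d (show (i + p) + 1 = j + p by omega)
  d_d hj hl x := by
    simp only [Units.smul_def, AddMonoidHom.coe_smul, Pi.smul_apply, map_zsmul, M.d_d, smul_zero]
  d_smul {i j n j' n'} hn hj' hn' h a x := by
    simp only [Units.smul_def, AddMonoidHom.coe_smul, Pi.smul_apply, map_zsmul]
    rw [M.d_smul _ (show (j + p) + 1 = j' + p by omega) _
      (show i + (j' + p) = n' + p by omega)]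

/-- The identification of components of equal degrees. -/
def castHom (M : DGModule 𝒜) {i j : ℤ} (h : i = j) : M.X i →+ M.X j :=
  h ▸ AddMonoidHom.id (M.X i)

@[simp] lemma castHom_rfl (M : DGModule 𝒜) {i : ℤ} (x : M.X i) : M.castHom rfl x = x := rfl

/-- The mapping cone `M[1] ⊕ N` of `α : M ⟶ N`, with differential
`(m, n) ↦ (- d m, α m + d n)` and componentwise action of scalars. -/
def cone {M N : DGModule 𝒜} (α : M ⟶ N) : DGModule 𝒜 where
  X i := M.X (i + 1) × N.X i
  smul {i j n} h := AddMonoidHom.mk'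
    (fun a => (M.smul (show i + (j + 1) = n + 1 by omega) a).prodMap (N.smul h a))
    (fun a b => by ext x <;> simp)
  one_smul x := Prod.ext ((M.shift 1).one_smul x.1) (N.one_smul x.2)
  mul_smul hm hn hn' a b x :=
    Prod.ext (M.mul_smul _ _ (by omega) a b x.1) (N.mul_smul hm hn hn' a b x.2)
  d {i j} h := AddMonoidHom.mk'
    (fun x => (- M.d (show (i + 1) + 1 = j + 1 by omega) x.1,
      Hom.f α j (M.castHom h x.1) + N.d h x.2))
    (fun x y => by
      ext
      · simp only [Prod.fst_add, map_add, neg_add]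
      · simp only [Prod.fst_add, Prod.snd_add, map_add]
        abel)
  d_d {i j l} hj hl x := by
    subst hj hl
    ext
    · simp [M.d_d]
    · simp [N.d_d, Hom.map_d]
  d_smul {i j n j' n'} hn hj' hn' h a x := by
    subst hj' hn'
    refine Prod.ext ?_ ?_
    · exact (congrArg Neg.neg (M.d_smul _ rfl _ (by omega) a x.1)).trans (map_neg _ _).symm
    · exact (congrArg₂ (· + ·) (Hom.map_smul α _ a x.1) (N.d_smul hn rfl rfl h a x.2)).trans
        (map_add _ _ _).symm

open Classical in
/-- The object `K_x` of `dg^S`: the cone of the identity of the graded ring at the place `x`, and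
zero at the other places. -/
noncomputable def coneAt (𝒜 : ℤ → AddSubgroup R) [GradedRing 𝒜] {S : Type v} (x : S) :
    S → DGModule 𝒜 :=
  fun y => if y = x then cone (𝟙 (unit 𝒜)) else zero 𝒜

/-- The shift in `dg^S`, taken componentwise. -/
def shiftPi {S : Type v} (M : S → DGModule 𝒜) (p : ℤ) : S → DGModule 𝒜 :=
  fun y => (M y).shift p

/-- Quasi-isomorphisms in `dg^S`. -/
def IsQuasiIsoPi {S : Type v} {M N : S → DGModule 𝒜} (φ : M ⟶ N) : Prop :=
  ∀ x : S, IsQuasiIso (φ x)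

/-- Morphisms in `dg^S` which are surjective at each place and in each degree. -/
def IsSurjectivePi {S : Type v} {M N : S → DGModule 𝒜} (φ : M ⟶ N) : Prop :=
  ∀ x : S, IsSurjective (φ x)

variable {S : Type v} {C : Type u} [Category.{v} C]

/-- The morphisms `f` of `C` such that `U f` is a quasi-isomorphism. -/
def weq (U : C ⥤ (S → DGModule 𝒜)) : MorphismProperty C :=
  fun _ _ f => IsQuasiIsoPi (U.map f)

/-- The morphisms `f` of `C` such that `U f` is surjective in each degree. -/
def fib (U : C ⥤ (S → DGModule 𝒜)) : MorphismProperty C :=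
  fun _ _ f => IsSurjectivePi (U.map f)

/-- The morphisms of `C` with the left lifting property with respect to `fib U ⊓ weq U`. -/
def cof (U : C ⥤ (S → DGModule 𝒜)) : MorphismProperty C :=
  (fib U ⊓ weq U).llp

end

end DGModule

/-! ### Quasi-isomorphisms in terms of elements -/

namespace CategoryTheory.ShortComplex

/-! This is a transfer of a cofibrantly generated model structure along `F ⊣ U`. In `dg^S` a map
`K_x[p] ⟶ N` is the same as an element of `N x`, and a map `k_x[p] ⟶ N` the same as a cocycle. Hence
lifting against all `0 ⟶ K_x[p]` means being surjective, and lifting against all `k_x[p] ⟶ K_x[p]`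
means being a surjective quasi-isomorphism. By adjunction the images of these two families under `F`
detect the fibrations and the trivial fibrations of `C`. Their sources are finitely presentable
because `U` preserves filtered colimits, so the small object argument gives both functorial
factorizations.

What remains is acyclicity: a map with the left lifting property against all fibrations must be a
weak equivalence (`llp_fib_le_weq`). No analysis of transfinite compositions of pushouts is needed.
Given `f : A ⟶ B`, add to `A` one copy of `F(K_x[p])` for every element of `U B`. The resulting map
to `B` is surjective after applying `U`. The inclusion of `A` is a weak equivalence: the hypothesis
allows summands to be added one at a time, and an arbitrary coproduct is the filtered colimit of its
finite subcoproducts, with quasi-isomorphisms stable under filtered colimits. If `f` lifts against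
fibrations, it is a retract of this inclusion. -/

/-- A morphism of short complexes of abelian groups is a quasi-isomorphism if and only if it is
injective and surjective on cycles modulo boundaries. -/
lemma ab_quasiIso_iff {S₁ S₂ : ShortComplex Ab.{v}} (φ : S₁ ⟶ S₂) :
    QuasiIso φ ↔
      (∀ z : S₁.X₂, S₁.g z = 0 → ∀ y : S₂.X₁, S₂.f y = φ.τ₂ z → ∃ x, S₁.f x = z) ∧
      (∀ y : S₂.X₂, S₂.g y = 0 → ∃ (z : S₁.X₂) (w : S₂.X₁),
        S₁.g z = 0 ∧ φ.τ₂ z = y + S₂.f w) := by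
  have comm₁ (x : S₁.X₁) : φ.τ₂ (S₁.f x) = S₂.f (φ.τ₁ x) :=
    (ConcreteCategory.congr_hom φ.comm₁₂ x).symm
  have comm₂ (x : S₁.X₂) : φ.τ₃ (S₁.g x) = S₂.g (φ.τ₂ x) :=
    (ConcreteCategory.congr_hom φ.comm₂₃ x).symm
  -- Homology is computed as the explicit quotient of cycles by boundaries; `k` is the map induced
  -- on cycles.
  let k : AddMonoidHom.ker S₁.g.hom →+ AddMonoidHom.ker S₂.g.hom :=
    (φ.τ₂.hom.comp (AddSubgroup.subtype _)).codRestrict _ (fun x => by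
      have h : S₁.g x.1 = 0 := x.2
      change S₂.g (φ.τ₂ x.1) = 0
      rw [← comm₂, h, map_zero])
  have hk : S₁.abToCycles.range ≤ AddSubgroup.comap k S₂.abToCycles.range := by
    rintro _ ⟨x, rfl⟩
    exact ⟨φ.τ₁ x, Subtype.ext (comm₁ x).symm⟩
  let γ : LeftHomologyMapData φ S₁.abLeftHomologyData S₂.abLeftHomologyData :=
    { φK := AddCommGrpCat.ofHom k
      φH := AddCommGrpCat.ofHom (QuotientAddGroup.map _ _ k hk)
      commi := rfl
      commf' := by
        ext x
        exact Subtype.ext (comm₁ x)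
      commπ := rfl }
  rw [γ.quasiIso_iff, ConcreteCategory.isIso_iff_bijective]
  change Function.Bijective (QuotientAddGroup.map _ _ k hk) ↔ _
  refine and_congr ?_ ?_
  · rw [injective_iff_map_eq_zero]
    constructor
    · intro h z hz y hy
      have := h (QuotientAddGroup.mk ⟨z, hz⟩)
        ((QuotientAddGroup.eq_zero_iff _).2 ⟨y, Subtype.ext hy⟩)
      obtain ⟨x, hx⟩ := (QuotientAddGroup.eq_zero_iff _).1 this
      exact ⟨x, congr_arg Subtype.val hx⟩
    · intro h a ha
      obtain ⟨⟨z, hz⟩, rfl⟩ := QuotientAddGroup.mk_surjective a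
      obtain ⟨y, hy⟩ := (QuotientAddGroup.eq_zero_iff _).1 ha
      obtain ⟨x, hx⟩ := h z hz y (congr_arg Subtype.val hy)
      exact (QuotientAddGroup.eq_zero_iff _).2 ⟨x, Subtype.ext hx⟩
  · constructor
    · intro h y hy
      obtain ⟨a, ha⟩ := h (QuotientAddGroup.mk ⟨y, hy⟩)
      obtain ⟨⟨z, hz⟩, rfl⟩ := QuotientAddGroup.mk_surjective a
      obtain ⟨w, hw⟩ := QuotientAddGroup.eq.1 ha.symm
      refine ⟨z, w, hz, ?_⟩
      have hw' : S₂.f w = - y + φ.τ₂ z := congr_arg Subtype.val hw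
      rw [hw', add_neg_cancel_left]
    · intro h a
      obtain ⟨⟨y, hy⟩, rfl⟩ := QuotientAddGroup.mk_surjective a
      obtain ⟨z, w, hz, hw⟩ := h y hy
      refine ⟨QuotientAddGroup.mk ⟨z, hz⟩,
        ((QuotientAddGroup.eq (s := S₂.abToCycles.range)).2 ⟨w, Subtype.ext ?_⟩).symm⟩
      change S₂.f w = - y + φ.τ₂ z
      rw [hw, neg_add_cancel_left]

end CategoryTheory.ShortComplex

namespace DGModule

variable {R : Type v} [Ring R] {𝒜 : ℤ → AddSubgroup R} [GradedRing 𝒜]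

/-- This removes homology objects from the rest of the argument: the two clauses are injectivity and
surjectivity on cohomology in degree `j`. -/
lemma isQuasiIso_iff {M N : DGModule 𝒜} (φ : M ⟶ N) :
    IsQuasiIso φ ↔ ∀ (i j l : ℤ) (hj : i + 1 = j) (hl : j + 1 = l),
      (∀ z : M.X j, M.d hl z = 0 → ∀ y : N.X i, N.d hj y = Hom.f φ j z → ∃ x, M.d hj x = z) ∧
      (∀ y : N.X j, N.d hl y = 0 → ∃ (z : M.X j) (w : N.X i),
        M.d hl z = 0 ∧ Hom.f φ j z = y + N.d hj w) := by
  have key (i j l : ℤ) (hj : i + 1 = j) (hl : j + 1 = l) :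
      QuasiIsoAt ((toCochainComplex 𝒜).map φ) j ↔
      (∀ z : M.X j, M.d hl z = 0 → ∀ y : N.X i, N.d hj y = Hom.f φ j z → ∃ x, M.d hj x = z) ∧
      (∀ y : N.X j, N.d hl y = 0 → ∃ (z : M.X j) (w : N.X i),
        M.d hl z = 0 ∧ Hom.f φ j z = y + N.d hj w) := by
    rw [quasiIsoAt_iff' _ i j l (by rw [CochainComplex.prev]; omega)
      (by rw [CochainComplex.next]; omega), ShortComplex.ab_quasiIso_iff]
    have hd (M : DGModule 𝒜) {i j : ℤ} (h : i + 1 = j) (x : M.X i) :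
        (((toCochainComplex 𝒜).obj M).d i j) x = M.d h x := by
      change (if h : i + 1 = j then AddCommGrpCat.ofHom (M.d h) else 0) x = _
      rw [dif_pos h]
      rfl
    simp only [HomologicalComplex.shortComplexFunctor'_obj_f,
      HomologicalComplex.shortComplexFunctor'_obj_g]
    refine and_congr (forall_congr' fun z => ?_) (forall_congr' fun y => ?_)
    · refine imp_congr (by erw [hd M hl]; rfl) (forall_congr' fun y => imp_congr ?_
        (exists_congr fun x => ?_))
      · erw [hd N hj]; rfl
      · erw [hd M hj]; rfl
    · refine imp_congr (by erw [hd N hl]; rfl) (exists_congr fun z => exists_congr fun w =>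
        and_congr ?_ ?_)
      · erw [hd M hl]; rfl
      · erw [hd N hj]; rfl
  constructor
  · intro h i j l hj hl
    have : QuasiIso ((toCochainComplex 𝒜).map φ) := h
    exact (key i j l hj hl).1 inferInstance
  · exact fun h => ⟨fun j => (key (j - 1) j (j + 1) (by omega) rfl).2 (h _ _ _ _ _)⟩

end DGModule

/-! ### Colimits of differential graded modules -/

/-- Since `J` need not be filtered, an element of the colimit need not come from a single stage;
equality of additive maps follows from the universal property instead. -/
lemma AddCommGrpCat.colimit_ext_apply {J : Type v} [SmallCategory J] (K : J ⥤ AddCommGrpCat.{v})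
    {A : Type v} [AddCommGroup A] (f g : (colimit K : AddCommGrpCat.{v}) →+ A)
    (h : ∀ (j : J) (x : K.obj j), f (colimit.ι K j x) = g (colimit.ι K j x))
    (x : (colimit K : AddCommGrpCat.{v})) : f x = g x := by
  have : AddCommGrpCat.ofHom f = AddCommGrpCat.ofHom g :=
    colimit.hom_ext fun j => by
      ext x
      exact h j x
  exact ConcreteCategory.congr_hom this x

namespace DGModule

section

variable {R : Type v} [Ring R] {𝒜 : ℤ → AddSubgroup R} [GradedRing 𝒜]

/-- The component of degree `i` of a differential graded module, as a functor. -/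
def component (𝒜 : ℤ → AddSubgroup R) [GradedRing 𝒜] (i : ℤ) :
    DGModule 𝒜 ⥤ AddCommGrpCat.{v} where
  obj M := AddCommGrpCat.of (M.X i)
  map φ := AddCommGrpCat.ofHom (Hom.f φ i)

/-- The action of a homogeneous scalar, as a natural transformation. -/
def smulNatTrans {i j n : ℤ} (h : i + j = n) (a : 𝒜 i) : component 𝒜 j ⟶ component 𝒜 n where
  app M := AddCommGrpCat.ofHom (M.smul h a)
  naturality M N φ := by
    ext x
    exact (Hom.map_smul φ h a x).symm

/-- The differential, as a natural transformation. -/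
def dNatTrans (𝒜 : ℤ → AddSubgroup R) [GradedRing 𝒜] {i j : ℤ} (h : i + 1 = j) :
    component 𝒜 i ⟶ component 𝒜 j where
  app M := AddCommGrpCat.ofHom (M.d h)
  naturality M N φ := by
    ext x
    exact (Hom.map_d φ h x).symm

variable {J : Type v} [SmallCategory J] (K : J ⥤ DGModule 𝒜)

/-- The map induced on colimits of components by a natural transformation of components. -/
noncomputable def colimitMap {i j : ℤ} (τ : component 𝒜 i ⟶ component 𝒜 j) :
    (colimit (K ⋙ component 𝒜 i) : AddCommGrpCat.{v}) →+
      (colimit (K ⋙ component 𝒜 j) : AddCommGrpCat.{v}) :=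
  (colimMap (Functor.whiskerLeft K τ)).hom

lemma colimitMap_ι {i j : ℤ} (τ : component 𝒜 i ⟶ component 𝒜 j) (k : J) (x : (K.obj k).X i) :
    colimitMap K τ (colimit.ι (K ⋙ component 𝒜 i) k x) =
      colimit.ι (K ⋙ component 𝒜 j) k ((τ.app (K.obj k)).hom x) :=
  ConcreteCategory.congr_hom (ι_colimMap (Functor.whiskerLeft K τ) k) x

/-- The colimit of differential graded modules, computed degreewise. -/
noncomputable def colimitObj : DGModule 𝒜 where
  X i := (colimit (K ⋙ component 𝒜 i) : AddCommGrpCat.{v})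
  smul h := AddMonoidHom.mk' (fun a => colimitMap K (smulNatTrans h a)) (fun a b => by
    ext x
    refine AddCommGrpCat.colimit_ext_apply _ _
      (colimitMap K (smulNatTrans h a) + colimitMap K (smulNatTrans h b)) (fun k x => ?_) x
    rw [AddMonoidHom.add_apply]
    erw [colimitMap_ι, colimitMap_ι, colimitMap_ι, ← map_add]
    exact congr_arg _ (DFunLike.congr_fun (map_add ((K.obj k).smul h) a b) x))
  one_smul x := by
    refine AddCommGrpCat.colimit_ext_apply _ (colimitMap K (smulNatTrans _ _))
      (AddMonoidHom.id _) (fun k x => ?_) x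
    erw [colimitMap_ι]
    exact congr_arg _ ((K.obj k).one_smul x)
  mul_smul hm hn hn' a b x := by
    refine AddCommGrpCat.colimit_ext_apply _ (colimitMap K (smulNatTrans _ _))
      ((colimitMap K (smulNatTrans _ _)).comp (colimitMap K (smulNatTrans _ _)))
      (fun k x => ?_) x
    rw [AddMonoidHom.comp_apply]
    erw [colimitMap_ι, colimitMap_ι, colimitMap_ι]
    exact congr_arg _ ((K.obj k).mul_smul hm hn hn' a b x)
  d h := colimitMap K (dNatTrans 𝒜 h)
  d_d hj hl x := by
    refine AddCommGrpCat.colimit_ext_apply _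
      ((colimitMap K (dNatTrans 𝒜 hl)).comp (colimitMap K (dNatTrans 𝒜 hj))) 0
      (fun k x => ?_) x
    rw [AddMonoidHom.comp_apply]
    erw [colimitMap_ι, colimitMap_ι]
    exact (congr_arg _ ((K.obj k).d_d hj hl x)).trans (map_zero _)
  d_smul hn hj' hn' h a x := by
    refine AddCommGrpCat.colimit_ext_apply _
      ((colimitMap K (dNatTrans 𝒜 hn')).comp (colimitMap K (smulNatTrans hn a)))
      ((colimitMap K (smulNatTrans h a)).comp (colimitMap K (dNatTrans 𝒜 hj')))
      (fun k x => ?_) x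
    rw [AddMonoidHom.comp_apply, AddMonoidHom.comp_apply]
    erw [colimitMap_ι, colimitMap_ι, colimitMap_ι, colimitMap_ι]
    exact congr_arg _ ((K.obj k).d_smul hn hj' hn' h a x)

/-- The colimit cocone of differential graded modules, computed degreewise. -/
noncomputable def colimitCocone : Cocone K where
  pt := colimitObj K
  ι :=
    { app k :=
        { f i := (colimit.ι (K ⋙ component 𝒜 i) k).hom
          map_smul hn a x := (colimitMap_ι K (smulNatTrans hn a) k x).symm
          map_d hj x := (colimitMap_ι K (dNatTrans 𝒜 hj) k x).symm }
      naturality _ _ g := Hom.ext (funext fun i =>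
        congr_arg AddCommGrpCat.Hom.hom ((colimit.w (K ⋙ component 𝒜 i) g).trans
          (Category.comp_id _).symm)) }

/-- The map from the colimit of components induced by a cocone. -/
noncomputable def colimitDesc (s : Cocone K) (i : ℤ) :
    (colimit (K ⋙ component 𝒜 i) : AddCommGrpCat.{v}) →+ s.pt.X i :=
  (colimit.desc (K ⋙ component 𝒜 i) ((component 𝒜 i).mapCocone s)).hom

lemma colimitDesc_ι (s : Cocone K) {i : ℤ} (k : J) (x : (K.obj k).X i) :
    colimitDesc K s i (colimit.ι (K ⋙ component 𝒜 i) k x) = Hom.f (s.ι.app k) i x :=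
  ConcreteCategory.congr_hom (colimit.ι_desc ((component 𝒜 i).mapCocone s) k) x

/-- The cocone `colimitCocone K` is a colimit. -/
noncomputable def colimitCoconeIsColimit : IsColimit (colimitCocone K) where
  desc s :=
    { f i := colimitDesc K s i
      map_smul {i j n} hn a x := by
        refine AddCommGrpCat.colimit_ext_apply _
          ((colimitDesc K s n).comp (colimitMap K (smulNatTrans hn a)))
          ((s.pt.smul hn a).comp (colimitDesc K s j)) (fun k x => ?_) x
        rw [AddMonoidHom.comp_apply, AddMonoidHom.comp_apply]
        erw [colimitMap_ι, colimitDesc_ι, colimitDesc_ι]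
        exact Hom.map_smul (s.ι.app k) hn a x
      map_d {i j} hj x := by
        refine AddCommGrpCat.colimit_ext_apply _
          ((colimitDesc K s j).comp (colimitMap K (dNatTrans 𝒜 hj)))
          ((s.pt.d hj).comp (colimitDesc K s i)) (fun k x => ?_) x
        rw [AddMonoidHom.comp_apply, AddMonoidHom.comp_apply]
        erw [colimitMap_ι, colimitDesc_ι, colimitDesc_ι]
        exact Hom.map_d (s.ι.app k) hj x }
  fac s k := Hom.ext (funext fun i => AddMonoidHom.ext fun x => colimitDesc_ι K s k x)
  uniq s m hm := Hom.ext (funext fun i => by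
    refine AddMonoidHom.ext fun x => AddCommGrpCat.colimit_ext_apply _ _ (colimitDesc K s i)
      (fun k x => ?_) x
    erw [colimitDesc_ι]
    exact DFunLike.congr_fun (congr_fun (congr_arg Hom.f (hm k)) i) x)

instance (i : ℤ) : PreservesColimitsOfShape J (component 𝒜 i) where
  preservesColimit {K} := preservesColimit_of_preserves_colimit_cocone (colimitCoconeIsColimit K)
    (IsColimit.ofIsoColimit (colimit.isColimit (K ⋙ component 𝒜 i)) (Cocone.ext (Iso.refl _)
      (fun _ => Category.comp_id _)))

variable {S : Type v}

instance preservesColimitsOfShape_eval (x : S) :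
    PreservesColimitsOfShape J (Pi.eval (fun _ : S => DGModule 𝒜) x) where
  preservesColimit {K} := preservesColimit_of_preserves_colimit_cocone
    (pi.coconeOfCoconeEvalIsColimit
      fun y => colimitCoconeIsColimit (K ⋙ Pi.eval (fun _ : S => DGModule 𝒜) y))
    (IsColimit.ofIsoColimit (colimitCoconeIsColimit (K ⋙ Pi.eval _ x)) (Cocone.ext (Iso.refl _)
      (fun _ => Category.comp_id _)))

/-- The underlying set of the component of degree `i` at the place `x`. -/
def elements (𝒜 : ℤ → AddSubgroup R) [GradedRing 𝒜] (x : S) (i : ℤ) :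
    (S → DGModule 𝒜) ⥤ Type v :=
  Pi.eval (fun _ : S => DGModule 𝒜) x ⋙ component 𝒜 i ⋙ forget AddCommGrpCat.{v}

/-- Filteredness enters only through the forgetful functor from abelian groups to sets; it makes
elements and their equalities visible at some stage. -/
instance [IsFiltered J] (x : S) (i : ℤ) : PreservesColimitsOfShape J (elements 𝒜 x i) := by
  unfold elements; infer_instance

variable [IsFiltered J] {K : J ⥤ (S → DGModule 𝒜)} {c : Cocone K}

lemma exists_rep_of_isColimit (hc : IsColimit c) {x : S} {i : ℤ} (m : (c.pt x).X i) :
    ∃ (j : J) (y : (K.obj j x).X i), Hom.f (c.ι.app j x) i y = m :=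
  Types.jointly_surjective_of_isColimit (isColimitOfPreserves (elements 𝒜 x i) hc) m

lemma exists_map_eq_of_isColimit (hc : IsColimit c) {x : S} {i : ℤ} {j : J}
    (y z : (K.obj j x).X i) (h : Hom.f (c.ι.app j x) i y = Hom.f (c.ι.app j x) i z) :
    ∃ (k : J) (g : j ⟶ k), Hom.f (K.map g x) i y = Hom.f (K.map g x) i z :=
  (Types.FilteredColimit.isColimit_eq_iff' (isColimitOfPreserves (elements 𝒜 x i) hc) y z).1 h

end

end DGModule

/-! ### Filtered colimits of quasi-isomorphisms; universal elements and cocycles -/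

namespace DGModule

section

variable {R : Type v} [Ring R] {𝒜 : ℤ → AddSubgroup R} [GradedRing 𝒜] {S : Type v}

lemma f_comp_apply {M N P : S → DGModule 𝒜} (φ : M ⟶ N) (ψ : N ⟶ P) (x : S) (i : ℤ)
    (m : (M x).X i) : Hom.f ((φ ≫ ψ) x) i m = Hom.f (ψ x) i (Hom.f (φ x) i m) := rfl

lemma f_ι_map {J : Type v} [SmallCategory J] {K : J ⥤ (S → DGModule 𝒜)} (c : Cocone K) {j k : J}
    (g : j ⟶ k) {x : S} {i : ℤ} (m : (K.obj j x).X i) :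
    Hom.f (c.ι.app k x) i (Hom.f (K.map g x) i m) = Hom.f (c.ι.app j x) i m := by
  rw [← f_comp_apply, c.w]

lemma d_f_ι {J : Type v} [SmallCategory J] {K : J ⥤ (S → DGModule 𝒜)} (c : Cocone K) (j : J)
    {x : S} {i i' : ℤ} (h : i + 1 = i') (m : (K.obj j x).X i) :
    (c.pt x).d h (Hom.f (c.ι.app j x) i m) = Hom.f (c.ι.app j x) i' ((K.obj j x).d h m) :=
  (Hom.map_d (c.ι.app j x) h m).symm

/-- Cocycles of a filtered colimit are represented by cocycles. -/
lemma exists_cocycle_of_isColimit {J : Type v} [SmallCategory J] [IsFiltered J]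
    {K : J ⥤ (S → DGModule 𝒜)} {c : Cocone K} (hc : IsColimit c) {x : S} {i i' : ℤ}
    (hi : i + 1 = i') (m : (c.pt x).X i) (hm : (c.pt x).d hi m = 0) :
    ∃ (j : J) (y : (K.obj j x).X i), Hom.f (c.ι.app j x) i y = m ∧ (K.obj j x).d hi y = 0 := by
  obtain ⟨j, y, rfl⟩ := exists_rep_of_isColimit hc m
  obtain ⟨k, g, h⟩ := exists_map_eq_of_isColimit hc ((K.obj j x).d hi y) 0
    (by rw [← d_f_ι, hm, map_zero])
  exact ⟨k, Hom.f (K.map g x) i y, f_ι_map c g y, by rw [← Hom.map_d, h, map_zero]⟩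

/-- Both clauses of the element criterion involve finitely many elements and equations, so they can
be checked at a sufficiently late stage. -/
lemma isQuasiIsoPi_of_isColimit {J : Type v} [SmallCategory J] [IsFiltered J]
    {K₁ K₂ : J ⥤ (S → DGModule 𝒜)} {c₁ : Cocone K₁} {c₂ : Cocone K₂}
    (hc₁ : IsColimit c₁) (hc₂ : IsColimit c₂) (f : K₁ ⟶ K₂)
    (hf : ∀ j, IsQuasiIsoPi (f.app j)) (φ : c₁.pt ⟶ c₂.pt)
    (hφ : ∀ j, c₁.ι.app j ≫ φ = f.app j ≫ c₂.ι.app j) : IsQuasiIsoPi φ := by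
  have hφ' (j : J) {x : S} {i : ℤ} (m : (K₁.obj j x).X i) :
      Hom.f (φ x) i (Hom.f (c₁.ι.app j x) i m) =
        Hom.f (c₂.ι.app j x) i (Hom.f (f.app j x) i m) := by
    rw [← f_comp_apply, ← f_comp_apply, hφ]
  have nat {j k : J} (g : j ⟶ k) {x : S} {i : ℤ} (m : (K₁.obj j x).X i) :
      Hom.f (f.app k x) i (Hom.f (K₁.map g x) i m) =
        Hom.f (K₂.map g x) i (Hom.f (f.app j x) i m) := by
    rw [← f_comp_apply, ← f_comp_apply, f.naturality]
  intro x
  rw [isQuasiIso_iff]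
  intro i j l hj hl
  constructor
  · intro z hz y hy
    obtain ⟨a, z, rfl, hz'⟩ := exists_cocycle_of_isColimit hc₁ hl z hz
    obtain ⟨b, y, rfl⟩ := exists_rep_of_isColimit hc₂ y
    -- At `k` both representatives exist, but the relation between them holds only in the colimit;
    -- it becomes true at the later stage `m`.
    let k := IsFiltered.max a b
    let p : a ⟶ k := IsFiltered.leftToMax a b
    let q : b ⟶ k := IsFiltered.rightToMax a b
    obtain ⟨m, g, hg⟩ := exists_map_eq_of_isColimit hc₂
      ((K₂.obj k x).d hj (Hom.f (K₂.map q x) i y))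
      (Hom.f (f.app k x) j (Hom.f (K₁.map p x) j z))
      (by rw [← d_f_ι, f_ι_map, hy, ← hφ', f_ι_map])
    obtain ⟨w, hw⟩ := (((isQuasiIso_iff _).1 (hf m x)) i j l hj hl).1
      (Hom.f (K₁.map g x) j (Hom.f (K₁.map p x) j z))
      (by rw [← Hom.map_d, ← Hom.map_d, hz', map_zero, map_zero])
      (Hom.f (K₂.map g x) i (Hom.f (K₂.map q x) i y)) (by rw [← Hom.map_d, hg, ← nat])
    exact ⟨Hom.f (c₁.ι.app m x) i w, by rw [d_f_ι, hw, f_ι_map, f_ι_map]⟩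
  · intro y hy
    obtain ⟨a, y, rfl, hy'⟩ := exists_cocycle_of_isColimit hc₂ hl y hy
    obtain ⟨z, w, hz, hw⟩ := (((isQuasiIso_iff _).1 (hf a x)) i j l hj hl).2 y hy'
    exact ⟨Hom.f (c₁.ι.app a x) j z, Hom.f (c₂.ι.app a x) i w,
      by rw [d_f_ι, hz, map_zero], by rw [hφ', hw, map_add, d_f_ι]⟩

lemma smul_one (M : DGModule 𝒜) {k i : ℤ} (h : k + i = i) (h₁ : (1 : R) ∈ 𝒜 k) (x : M.X i) :
    M.smul h ⟨1, h₁⟩ x = x := by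
  obtain rfl : k = 0 := by omega
  exact M.one_smul x

/-- Scalars that agree in `R` may have types indexed by different expressions for the same degree.
-/
lemma smul_congr (M : DGModule 𝒜) {i i' j n : ℤ} (h : i + j = n) (h' : i' + j = n)
    {a : 𝒜 i} {a' : 𝒜 i'} (ha : a.1 = a'.1) (x : M.X j) : M.smul h a x = M.smul h' a' x := by
  obtain rfl : i = i' := by omega
  obtain rfl : a = a' := Subtype.ext ha
  rfl

lemma castHom_unit_val {i j : ℤ} (h : i = j) (a : 𝒜 i) :
    ((unit 𝒜).castHom h a : 𝒜 j).1 = a.1 := by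
  subst h
  rfl

lemma one_mem_of_eq_zero {k : ℤ} (hk : k = 0) : (1 : R) ∈ 𝒜 k :=
  hk ▸ SetLike.GradedOne.one_mem

/-- The element of `k[p]` in degree `n = - p` corresponding to `1` is the universal cocycle. -/
lemma exists_universal_cocycle (n p : ℤ) (hn : n + p = 0) :
    ∃ ζ : ((unit 𝒜).shift p).X n, ((unit 𝒜).shift p).d rfl ζ = 0 ∧
      ∀ (N : DGModule 𝒜) (y : N.X n), N.d rfl y = 0 →
        ∃! φ : (unit 𝒜).shift p ⟶ N, Hom.f φ n ζ = y := by
  let ζ : 𝒜 (n + p) := ⟨1, one_mem_of_eq_zero hn⟩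
  refine ⟨ζ, ?_, fun N y hy => ⟨?_, ?_, ?_⟩⟩
  · change p.negOnePow • (0 : 𝒜 (n + 1 + p)) = 0
    rw [smul_zero]
  -- The map is forced to be `b ↦ b y`; it commutes with differentials because `y` is a cocycle and
  -- the ring has zero differential.
  · exact
      { f i := (AddMonoidHom.flip (N.smul (show i + p + n = i by omega)) y : 𝒜 (i + p) →+ N.X i)
        map_smul {i j m} h a b := by
          refine Eq.trans ?_ (N.mul_smul (show j + p + n = j by omega) h
            (show i + (j + p) + n = m by omega) a b y)
          exact N.smul_congr _ _ (by rfl) y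
        map_d {i j} h b := by
          refine Eq.trans ?_ (N.d_smul (show i + p + n = i by omega) rfl h
            (by omega) b y).symm
          rw [hy, map_zero]
          change N.smul _ (p.negOnePow • (0 : 𝒜 (j + p))) y = 0
          rw [smul_zero, map_zero, AddMonoidHom.zero_apply] }
  · exact N.smul_one _ _ y
  · intro φ hφ
    refine Hom.ext (funext fun i => AddMonoidHom.ext fun b => ?_)
    have hb : ((unit 𝒜).shift p).smul (show i + p + n = i by omega) (b : 𝒜 (i + p)) ζ = b :=
      Subtype.ext (mul_one (b : 𝒜 (i + p)).1)
    exact (congr_arg (Hom.f φ i) hb.symm).trans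
      ((Hom.map_smul φ _ _ _).trans (congr_arg (N.smul _ _) hφ))

/-- The element of `Cone(id_k)[p]` in degree `n = - p - 1` corresponding to `1` is a universal
element. -/
lemma exists_universal_element (n p : ℤ) (hn : n + p + 1 = 0) :
    ∃ κ : ((cone (𝟙 (unit 𝒜))).shift p).X n, ∀ (N : DGModule 𝒜) (y : N.X n),
        ∃! φ : (cone (𝟙 (unit 𝒜))).shift p ⟶ N, Hom.f φ n κ = y := by
  let κ : 𝒜 (n + p + 1) × 𝒜 (n + p) := (⟨1, one_mem_of_eq_zero hn⟩, 0)
  have hd {i j : ℤ} (h : i + 1 = j) (b : 𝒜 (i + p + 1) × 𝒜 (i + p)) :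
      ((cone (𝟙 (unit 𝒜))).shift p).d h b =
        p.negOnePow • ((0, (unit 𝒜).castHom (by omega) b.1) : 𝒜 (j + p + 1) × 𝒜 (j + p)) := by
    change p.negOnePow • ((-0, (unit 𝒜).castHom _ b.1 + 0) : 𝒜 (j + p + 1) × 𝒜 (j + p)) = _
    exact congr_arg (p.negOnePow • ·) (Prod.ext neg_zero (add_zero _))
  refine ⟨κ, fun N y => ⟨?_, ?_, ?_⟩⟩
  -- Since `κ = (1, 0)` must go to `y` and `d κ = (-1)^p (0, 1)` to `d y`, the map is `(b₁, b₂) ↦ b₁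
  -- y + (-1)^p b₂ d y`.
  · exact
      { f i := (AddMonoidHom.coprod
          (AddMonoidHom.flip (N.smul (show i + p + 1 + n = i by omega)) y)
          (p.negOnePow • AddMonoidHom.flip (N.smul (show i + p + (n + 1) = i by omega))
            (N.d rfl y)) : 𝒜 (i + p + 1) × 𝒜 (i + p) →+ N.X i)
        map_smul {i j m} h a b := by
          change N.smul _ _ y + p.negOnePow • N.smul _ _ (N.d rfl y) =
            N.smul h a (N.smul _ _ y + p.negOnePow • N.smul _ _ (N.d rfl y))
          rw [map_add, Units.smul_def, Units.smul_def, map_zsmul]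
          refine congr_arg₂ (· + ·) ?_ (congr_arg _ ?_)
          · refine Eq.trans ?_ (N.mul_smul (show j + p + 1 + n = j by omega) h
              (show i + (j + p + 1) + n = m by omega) a b.1 y)
            exact N.smul_congr _ _ (by rfl) y
          · refine Eq.trans ?_ (N.mul_smul (show j + p + (n + 1) = j by omega) h
              (show i + (j + p) + (n + 1) = m by omega) a b.2 _)
            exact N.smul_congr _ _ (by rfl) _
        map_d {i j} h b := by
          have hr (a : 𝒜 (i + p + 1)) (a' : 𝒜 (i + p)) :
              N.d h (N.smul (show i + p + 1 + n = i by omega) a y +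
                p.negOnePow • N.smul (show i + p + (n + 1) = i by omega) a' (N.d rfl y)) =
              N.smul (show i + p + 1 + (n + 1) = j by omega) a (N.d rfl y) := by
            rw [Units.smul_def, map_add, map_zsmul, N.d_smul _ rfl h (by omega),
              N.d_smul _ rfl h (by omega), N.d_d, map_zero, smul_zero, add_zero]
          have hs (a : 𝒜 (j + p)) :
              N.smul (show j + p + 1 + n = j by omega) (p.negOnePow • 0) y +
                p.negOnePow • N.smul (show j + p + (n + 1) = j by omega) (p.negOnePow • a)
                  (N.d rfl y) = N.smul (by omega) a (N.d rfl y) := by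
            rw [smul_zero, map_zero, AddMonoidHom.zero_apply, zero_add, Units.smul_def,
              Units.smul_def, map_zsmul, AddMonoidHom.smul_apply, ← Units.smul_def,
              ← Units.smul_def, smul_smul, Int.units_mul_self, _root_.one_smul]
          refine (congr_arg _ (hd h b)).trans ((hs _).trans (Eq.trans ?_ (hr _ _).symm))
          exact N.smul_congr _ _ (castHom_unit_val _ _) _ }
  · change N.smul _ _ y + p.negOnePow • N.smul _ 0 (N.d rfl y) = y
    rw [map_zero, AddMonoidHom.zero_apply, smul_zero, add_zero]
    exact N.smul_one _ _ y
  · intro φ hφ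
    refine Hom.ext (funext fun i => AddMonoidHom.ext fun b => ?_)
    obtain ⟨b₁, b₂⟩ : 𝒜 (i + p + 1) × 𝒜 (i + p) := b
    let M := (cone (𝟙 (unit 𝒜))).shift p
    have h₁ (e : M.X (n + 1)) :
        p.negOnePow • M.smul (show i + p + (n + 1) = i by omega) b₂ (p.negOnePow • e) =
          M.smul (by omega) b₂ e := by
      rw [Units.smul_def, Units.smul_def, map_zsmul, ← Units.smul_def, ← Units.smul_def,
        smul_smul, Int.units_mul_self, _root_.one_smul]
    have h₂ (e : M.X n) (he : Hom.f φ n e = y) :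
        Hom.f φ i (M.smul (show i + p + 1 + n = i by omega) b₁ e +
          p.negOnePow • M.smul (show i + p + (n + 1) = i by omega) b₂ (M.d rfl e)) =
        N.smul (by omega) b₁ y + p.negOnePow • N.smul (by omega) b₂ (N.d rfl y) := by
      rw [map_add, Units.smul_def, Units.smul_def, map_zsmul, Hom.map_smul, Hom.map_smul,
        Hom.map_d, he]
    -- Uniqueness: `b = b₁ κ + (-1)^p b₂ d κ`, so the value of `φ` at `κ` determines `φ`.
    refine (congr_arg (Hom.f φ i) ?_).trans (h₂ κ hφ)
    refine Eq.trans ?_ (congr_arg (fun t => M.smul _ b₁ κ + t)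
      ((congr_arg (fun t => p.negOnePow • M.smul _ b₂ t) (hd rfl κ)).trans (h₁ _)).symm)
    refine Prod.ext (Subtype.ext ?_) (Subtype.ext ?_)
    · change b₁.1 = b₁.1 * 1 + b₂.1 * 0
      rw [mul_one, mul_zero, add_zero]
    · change b₂.1 = b₁.1 * 0 + b₂.1 * ((unit 𝒜).castHom _ κ.1 : 𝒜 _).1
      rw [mul_zero, zero_add]
      exact ((congr_arg _ (castHom_unit_val _ _)).trans (mul_one _)).symm

end

end DGModule

/-! ### The generating maps in `dg^S` and their lifting properties -/

namespace DGModule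

section

variable {R : Type v} [Ring R] {𝒜 : ℤ → AddSubgroup R} [GradedRing 𝒜] {S : Type v}

/-- The zero morphism. -/
def zeroHom (M N : DGModule 𝒜) : M ⟶ N where
  f _ := 0
  map_smul _ _ _ := (map_zero _).symm
  map_d _ _ := (map_zero _).symm

lemma hom_eq_of_subsingleton {M N : DGModule 𝒜} (hM : ∀ i, Subsingleton (M.X i)) (φ ψ : M ⟶ N) :
    φ = ψ :=
  Hom.ext (funext fun i => AddMonoidHom.ext fun m => by
    rw [Subsingleton.elim m 0, map_zero, map_zero])

/-- A morphism from a family concentrated at `x` is determined by its component at `x`. -/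
lemma existsUnique_hom_of_concentrated {M : S → DGModule 𝒜} {x : S}
    (hM : ∀ y, y ≠ x → ∀ i, Subsingleton ((M y).X i)) {N : S → DGModule 𝒜} (g : M x ⟶ N x) :
    ∃! φ : M ⟶ N, φ x = g := by
  classical
  refine ⟨fun y => if h : y = x then by subst h; exact g else zeroHom _ _, ?_, fun φ hφ => ?_⟩
  · exact dif_pos rfl
  · funext y
    by_cases h : y = x
    · subst h
      exact hφ.trans (by rw [dif_pos rfl])
    · exact hom_eq_of_subsingleton (hM y h) _ _

/-- The element `κ` of degree `n` at the place `x` freely generates `M`. -/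
def IsUniversalElement (M : S → DGModule 𝒜) (x : S) {n : ℤ} (κ : (M x).X n) : Prop :=
  ∀ (N : S → DGModule 𝒜) (y : (N x).X n), ∃! φ : M ⟶ N, Hom.f (φ x) n κ = y

/-- The cocycle `ζ` of degree `n` at the place `x` freely generates `M`. -/
def IsUniversalCocycle (M : S → DGModule 𝒜) (x : S) {n : ℤ} (ζ : (M x).X n) : Prop :=
  (M x).d rfl ζ = 0 ∧ ∀ (N : S → DGModule 𝒜) (y : (N x).X n), (N x).d rfl y = 0 →
    ∃! φ : M ⟶ N, Hom.f (φ x) n ζ = y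

lemma existsUnique_hom_pi {M : S → DGModule 𝒜} {x : S}
    (hM : ∀ y, y ≠ x → ∀ i, Subsingleton ((M y).X i)) {N : S → DGModule 𝒜} {P : (M x ⟶ N x) → Prop}
    (h : ∃! g, P g) : ∃! φ : M ⟶ N, P (φ x) := by
  obtain ⟨g, hg, hg'⟩ := h
  obtain ⟨φ, hφ, hφ'⟩ := existsUnique_hom_of_concentrated hM g
  subst hφ
  exact ⟨φ, hg, fun ψ hψ => hφ' ψ (hg' _ hψ)⟩

lemma exists_isUniversalElement (x : S) {n p : ℤ} (h : n + p + 1 = 0) :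
    ∃ κ : (shiftPi (coneAt 𝒜 x) p x).X n, IsUniversalElement (shiftPi (coneAt 𝒜 x) p) x κ := by
  have key (M : DGModule 𝒜) (hM : M = (cone (𝟙 (unit 𝒜))).shift p) :
      ∃ κ : M.X n, ∀ (N : DGModule 𝒜) (y : N.X n), ∃! φ : M ⟶ N, Hom.f φ n κ = y := by
    subst hM
    exact exists_universal_element n p h
  obtain ⟨κ, hκ⟩ := key (shiftPi (coneAt 𝒜 x) p x) (congr_arg (shift · p) (if_pos rfl))
  refine ⟨κ, fun N y => existsUnique_hom_pi (fun z hz i => ?_) (hκ (N x) y)⟩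
  change Subsingleton ((coneAt 𝒜 x z).X (i + p))
  rw [show coneAt 𝒜 x z = zero 𝒜 from if_neg hz]
  exact inferInstanceAs (Subsingleton PUnit)

open Classical in
/-- The object of `dg^S` given by the graded ring at the place `x`, and zero at the other
places. -/
noncomputable def unitAt (𝒜 : ℤ → AddSubgroup R) [GradedRing 𝒜] (x : S) : S → DGModule 𝒜 :=
  fun y => if y = x then unit 𝒜 else zero 𝒜

lemma exists_isUniversalCocycle (x : S) {n p : ℤ} (h : n + p = 0) :
    ∃ ζ : (shiftPi (unitAt 𝒜 x) p x).X n, IsUniversalCocycle (shiftPi (unitAt 𝒜 x) p) x ζ := by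
  have key (M : DGModule 𝒜) (hM : M = (unit 𝒜).shift p) :
      ∃ ζ : M.X n, M.d rfl ζ = 0 ∧ ∀ (N : DGModule 𝒜) (y : N.X n), N.d rfl y = 0 →
        ∃! φ : M ⟶ N, Hom.f φ n ζ = y := by
    subst hM
    exact exists_universal_cocycle n p h
  obtain ⟨ζ, hζ, hζ'⟩ := key (shiftPi (unitAt 𝒜 x) p x) (congr_arg (shift · p) (if_pos rfl))
  refine ⟨ζ, hζ, fun N y hy => existsUnique_hom_pi (fun z hz i => ?_) (hζ' (N x) y hy)⟩
  change Subsingleton ((unitAt 𝒜 x z).X (i + p))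
  rw [show unitAt 𝒜 x z = zero 𝒜 from if_neg hz]
  exact inferInstanceAs (Subsingleton PUnit)

/-- Maps out of `M` are cocycles of degree `n` at `x`, and taking cocycles commutes with filtered
colimits. -/
lemma IsUniversalCocycle.isFinitelyPresentable {M : S → DGModule 𝒜} {x : S} {n : ℤ}
    {ζ : (M x).X n} (h : IsUniversalCocycle M x ζ) : IsFinitelyPresentable.{v} M := by
  rw [isFinitelyPresentable_iff_preservesFilteredColimitsOfSize]
  refine ⟨fun J _ _ => ⟨fun {K} => ⟨fun {c} hc =>
    ⟨Types.FilteredColimit.isColimitOf' _ _ ?_ ?_⟩⟩⟩⟩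
  · intro (φ : M ⟶ c.pt)
    obtain ⟨j, y, hy, hy'⟩ := exists_cocycle_of_isColimit hc rfl (Hom.f (φ x) n ζ)
      (by rw [← Hom.map_d, h.1, map_zero])
    obtain ⟨ψ, hψ, -⟩ := h.2 (K.obj j) y hy'
    refine ⟨j, ψ, ?_⟩
    change φ = ψ ≫ c.ι.app j
    refine (h.2 c.pt (Hom.f (φ x) n ζ) (by rw [← Hom.map_d, h.1, map_zero])).unique rfl ?_
    rw [f_comp_apply, hψ, hy]
  · intro j (φ : M ⟶ K.obj j) (ψ : M ⟶ K.obj j) (hφψ : φ ≫ c.ι.app j = ψ ≫ c.ι.app j)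
    obtain ⟨k, g, hg⟩ := exists_map_eq_of_isColimit hc (Hom.f (φ x) n ζ) (Hom.f (ψ x) n ζ)
      (by rw [← f_comp_apply, ← f_comp_apply, hφψ])
    refine ⟨k, g, ?_⟩
    change φ ≫ K.map g = ψ ≫ K.map g
    exact (h.2 (K.obj k) (Hom.f (K.map g x) n (Hom.f (φ x) n ζ))
      (by rw [← Hom.map_d, ← Hom.map_d, h.1, map_zero, map_zero])).unique rfl hg.symm

/-- The zero object of `dg^S`. -/
def zeroPi (𝒜 : ℤ → AddSubgroup R) [GradedRing 𝒜] (S : Type v) : S → DGModule 𝒜 :=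
  fun _ => zero 𝒜

instance (M : S → DGModule 𝒜) : Unique (zeroPi 𝒜 S ⟶ M) where
  default _ := zeroHom _ _
  uniq _ := funext fun _ =>
    hom_eq_of_subsingleton (fun _ => inferInstanceAs (Subsingleton PUnit)) _ _

instance isFinitelyPresentable_zeroPi : IsFinitelyPresentable.{v} (zeroPi 𝒜 S) := by
  rw [isFinitelyPresentable_iff_preservesFilteredColimitsOfSize]
  refine ⟨fun J _ _ => ⟨fun {K} => ⟨fun {c} hc =>
    ⟨Types.FilteredColimit.isColimitOf' _ _ ?_ ?_⟩⟩⟩⟩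
  · intro (φ : zeroPi 𝒜 S ⟶ c.pt)
    exact ⟨Classical.choice IsFiltered.nonempty, (default : zeroPi 𝒜 S ⟶ _),
      Subsingleton.elim (α := zeroPi 𝒜 S ⟶ _) _ _⟩
  · intro j _ _ _
    exact ⟨j, 𝟙 j, Subsingleton.elim (α := zeroPi 𝒜 S ⟶ _) _ _⟩

lemma IsUniversalElement.hasLiftingProperty_iff {T : S → DGModule 𝒜} {x : S} {n : ℤ}
    {κ : (T x).X n} (h : IsUniversalElement T x κ) {M N : S → DGModule 𝒜} (f : M ⟶ N) :
    HasLiftingProperty (default : zeroPi 𝒜 S ⟶ T) f ↔ Function.Surjective (Hom.f (f x) n) := by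
  constructor
  · intro _ y
    obtain ⟨ψ, hψ, -⟩ := h N y
    have sq : CommSq (default : zeroPi 𝒜 S ⟶ M) (default : zeroPi 𝒜 S ⟶ T) f ψ :=
      ⟨Subsingleton.elim _ _⟩
    exact ⟨Hom.f (sq.lift x) n κ, by rw [← f_comp_apply, sq.fac_right, hψ]⟩
  · intro hf
    refine ⟨fun {φ ψ} sq => ?_⟩
    obtain ⟨y, hy⟩ := hf (Hom.f (ψ x) n κ)
    obtain ⟨l, hl, -⟩ := h M y
    exact ⟨⟨l, Subsingleton.elim _ _, (h N (Hom.f (ψ x) n κ)).unique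
      (by rw [f_comp_apply, hl, hy]) rfl⟩⟩

/-- A square from `ι` to `f` amounts to a cocycle `z` of `M` and an element `y` of `N` with `d y = f
z`; a lift amounts to the element `w`. -/
lemma IsUniversalCocycle.hasLiftingProperty_iff {Z T : S → DGModule 𝒜} {x : S} {n : ℤ}
    {ζ : (Z x).X (n + 1)} {κ : (T x).X n} (hζ : IsUniversalCocycle Z x ζ)
    (hκ : IsUniversalElement T x κ) (ι : Z ⟶ T) (hι : Hom.f (ι x) (n + 1) ζ = (T x).d rfl κ)
    {M N : S → DGModule 𝒜} (f : M ⟶ N) :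
    HasLiftingProperty ι f ↔ ∀ z : (M x).X (n + 1), (M x).d rfl z = 0 →
      ∀ y : (N x).X n, (N x).d rfl y = Hom.f (f x) (n + 1) z →
        ∃ w, (M x).d rfl w = z ∧ Hom.f (f x) n w = y := by
  constructor
  · intro _ z hz y hy
    obtain ⟨φ, hφ, -⟩ := hζ.2 M z hz
    obtain ⟨ψ, hψ, -⟩ := hκ N y
    have sq : CommSq φ ι f ψ := ⟨(hζ.2 N (Hom.f (f x) (n + 1) z)
      (by rw [← Hom.map_d, hz, map_zero])).unique (by rw [f_comp_apply, hφ])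
      (by rw [f_comp_apply, hι, Hom.map_d, hψ, hy])⟩
    refine ⟨Hom.f (sq.lift x) n κ, ?_, by rw [← f_comp_apply, sq.fac_right, hψ]⟩
    rw [← Hom.map_d, ← hι, ← f_comp_apply, sq.fac_left, hφ]
  · intro hf
    refine ⟨fun {φ ψ} sq => ?_⟩
    have hz : (M x).d rfl (Hom.f (φ x) (n + 1) ζ) = 0 := by rw [← Hom.map_d, hζ.1, map_zero]
    obtain ⟨w, hw, hw'⟩ := hf (Hom.f (φ x) (n + 1) ζ) hz (Hom.f (ψ x) n κ)
      (by rw [← Hom.map_d, ← hι, ← f_comp_apply, ← f_comp_apply, sq.w])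
    obtain ⟨l, hl, -⟩ := hκ M w
    exact ⟨⟨l, (hζ.2 M _ hz).unique (by rw [f_comp_apply, hι, Hom.map_d, hl, hw]) rfl,
      (hκ N (Hom.f (ψ x) n κ)).unique (by rw [f_comp_apply, hl, hw']) rfl⟩⟩

/-- A morphism is a surjective quasi-isomorphism if and only if elements `y` can be lifted
together with a given lift of their coboundary. -/
lemma isSurjective_and_isQuasiIso_iff {M N : DGModule 𝒜} (f : M ⟶ N) :
    IsSurjective f ∧ IsQuasiIso f ↔ ∀ (n : ℤ) (z : M.X (n + 1)), M.d rfl z = 0 →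
      ∀ y : N.X n, N.d rfl y = Hom.f f (n + 1) z → ∃ w, M.d rfl w = z ∧ Hom.f f n w = y := by
  rw [isQuasiIso_iff]
  constructor
  · rintro ⟨hs, hq⟩ n z hz y hy
    -- First solve `d a = z`. The error `f a - y` is a cocycle, hence equal to `f c - d w` for a
    -- cocycle `c`; with `f b = w`, the element `a - c + d b` has both required properties.
    obtain ⟨a, rfl⟩ := (hq n (n + 1) (n + 1 + 1) rfl rfl).1 z hz y hy
    have hd : N.d rfl (Hom.f f n a - y) = 0 := by rw [map_sub, ← Hom.map_d, hy, sub_self]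
    obtain ⟨m, rfl⟩ : ∃ m, m + 1 = n := ⟨n - 1, by omega⟩
    obtain ⟨c, w, hc, hw⟩ := (hq m (m + 1) (m + 1 + 1) rfl rfl).2 _ hd
    obtain ⟨b, rfl⟩ := hs m w
    refine ⟨a - c + M.d rfl b, ?_, ?_⟩
    · rw [map_add, map_sub, hc, M.d_d, sub_zero, add_zero]
    · rw [map_add, map_sub, hw, Hom.map_d]
      abel
  · intro h
    -- The case `z = 0`: every cocycle of `N` lifts to a cocycle of `M`.
    have hZ (n : ℤ) (y : N.X n) (hy : N.d rfl y = 0) : ∃ w, M.d rfl w = 0 ∧ Hom.f f n w = y :=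
      h n 0 (map_zero _) y (by rw [hy, map_zero])
    refine ⟨fun n y => ?_, ?_⟩
    · obtain ⟨z, hz, hz'⟩ := hZ (n + 1) (N.d rfl y) (N.d_d _ _ _)
      obtain ⟨w, -, hw⟩ := h n z hz y hz'.symm
      exact ⟨w, hw⟩
    · rintro i _ _ rfl rfl
      refine ⟨fun z hz y hy => ?_, fun y hy => ?_⟩
      · obtain ⟨w, hw, -⟩ := h i z hz y hy
        exact ⟨w, hw⟩
      · obtain ⟨z, hz, hz'⟩ := hZ _ y hy
        exact ⟨z, 0, hz, by rw [hz', map_zero, add_zero]⟩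

/-- The morphisms `0 ⟶ K_x[p]`. -/
noncomputable def acyclicGenerators (𝒜 : ℤ → AddSubgroup R) [GradedRing 𝒜] (S : Type v) (e : S × ℤ) :
    zeroPi 𝒜 S ⟶ shiftPi (coneAt 𝒜 e.1) e.2 :=
  default

lemma hasLiftingProperty_acyclicGenerators_iff {M N : S → DGModule 𝒜} (f : M ⟶ N) :
    (∀ e, HasLiftingProperty (acyclicGenerators 𝒜 S e) f) ↔ IsSurjectivePi f := by
  constructor
  · intro h x n
    obtain ⟨κ, hκ⟩ := exists_isUniversalElement (𝒜 := 𝒜) x (n := n) (p := - n - 1) (by omega)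
    exact (hκ.hasLiftingProperty_iff f).1 (h (x, - n - 1))
  · rintro h ⟨x, p⟩
    obtain ⟨κ, hκ⟩ := exists_isUniversalElement (𝒜 := 𝒜) x (n := - p - 1) (p := p) (by omega)
    exact (hκ.hasLiftingProperty_iff f).2 (h x _)

/-- The map `ι` is the one classified by the cocycle `d κ`, where `κ` is the universal element, of
degree `- p - 1`. -/
lemma exists_generator (x : S) (p : ℤ) :
    ∃ ι : shiftPi (unitAt 𝒜 x) p ⟶ shiftPi (coneAt 𝒜 x) p,
      ∀ {M N : S → DGModule 𝒜} (f : M ⟶ N), HasLiftingProperty ι f ↔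
        ∀ z : (M x).X (- p - 1 + 1), (M x).d rfl z = 0 →
          ∀ y : (N x).X (- p - 1), (N x).d rfl y = Hom.f (f x) (- p - 1 + 1) z →
            ∃ w, (M x).d rfl w = z ∧ Hom.f (f x) (- p - 1) w = y := by
  obtain ⟨κ, hκ⟩ := exists_isUniversalElement (𝒜 := 𝒜) x (n := - p - 1) (p := p) (by omega)
  obtain ⟨ζ, hζ⟩ := exists_isUniversalCocycle (𝒜 := 𝒜) x (n := - p - 1 + 1) (p := p) (by omega)
  obtain ⟨ι, hι, -⟩ := hζ.2 (shiftPi (coneAt 𝒜 x) p) ((shiftPi (coneAt 𝒜 x) p x).d rfl κ)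
    ((shiftPi (coneAt 𝒜 x) p x).d_d _ _ _)
  exact ⟨ι, fun f => hζ.hasLiftingProperty_iff hκ ι hι f⟩

/-- The morphisms `k_x[p] ⟶ K_x[p]`. -/
noncomputable def generators (𝒜 : ℤ → AddSubgroup R) [GradedRing 𝒜] (S : Type v) (e : S × ℤ) :
    shiftPi (unitAt 𝒜 e.1) e.2 ⟶ shiftPi (coneAt 𝒜 e.1) e.2 :=
  (exists_generator e.1 e.2).choose

lemma hasLiftingProperty_generators_iff {M N : S → DGModule 𝒜} (f : M ⟶ N) :
    (∀ e, HasLiftingProperty (generators 𝒜 S e) f) ↔ IsSurjectivePi f ∧ IsQuasiIsoPi f := by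
  have h (e : S × ℤ) := (exists_generator (𝒜 := 𝒜) e.1 e.2).choose_spec f
  refine (forall_congr' h).trans (Iff.trans ?_ forall_and)
  simp only [isSurjective_and_isQuasiIso_iff]
  constructor
  · intro h x n
    obtain ⟨p, rfl⟩ : ∃ p, - p - 1 = n := ⟨- n - 1, by omega⟩
    exact h (x, p)
  · exact fun h e => h e.1 _

instance isFinitelyPresentable_shiftPi_unitAt (x : S) (p : ℤ) :
    IsFinitelyPresentable.{v} (shiftPi (unitAt 𝒜 x) p) :=
  (exists_isUniversalCocycle (𝒜 := 𝒜) x (neg_add_cancel p)).choose_spec.isFinitelyPresentable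

end

end DGModule

/-! ### Adding negligible summands; the small object argument -/

namespace CategoryTheory.MorphismProperty

section

variable {C : Type u} [Category.{v} C] [HasBinaryCoproducts C] [HasCoproducts.{v} C]
  (W : MorphismProperty C)

/-- The objects `G` such that `A ⟶ G ⨿ A` is in `W` for all objects `A`. -/
def isNegligible : ObjectProperty C := fun G => ∀ A : C, W (coprod.inr : A ⟶ G ⨿ A)

variable {W}

/-- Induction on `T`. Negligibility quantifies over all objects, so it applies again after earlier
summands have been added to `A`. -/
lemma coprod_inl_of_finite [W.IsMultiplicative] [W.RespectsIso] (A : C) (T : Type v) :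
    Finite T → ∀ G : T → C, (∀ t, W.isNegligible (G t)) → W (coprod.inl : A ⟶ A ⨿ ∐ G) := by
  intro hT
  refine Finite.induction_empty_option
    (P := fun T : Type v => ∀ G : T → C,
      (∀ t, W.isNegligible (G t)) → W (coprod.inl : A ⟶ A ⨿ ∐ G))
    ?_ ?_ ?_ T
  · intro T T' e h G hG
    have := h (G ∘ e) (fun t => hG _)
    let i : A ⨿ ∐ (G ∘ e) ≅ A ⨿ ∐ G := coprod.mapIso (Iso.refl _) (Limits.Sigma.reindex e G)
    have fac : (coprod.inl : A ⟶ A ⨿ ∐ G) = coprod.inl ≫ i.hom := by simp [i]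
    rw [fac]
    exact (W.cancel_right_of_respectsIso _ _).2 this
  · intro G _
    let i : A ≅ A ⨿ ∐ G :=
      { hom := coprod.inl
        inv := coprod.desc (𝟙 _) (Limits.Sigma.desc fun t => t.elim)
        hom_inv_id := by simp [coprod.inl_desc]
        inv_hom_id := by
          ext t
          · simp [coprod.inl_desc]
          · exact t.elim }
    have : IsIso i.hom := i.isIso_hom
    exact W.of_isIso i.hom
  · intro T _ h G hG
    let G' : T → C := fun t => G (some t)
    have h₁ := h G' (fun t => hG _)
    let i : G none ⨿ (A ⨿ ∐ G') ≅ A ⨿ ∐ G :=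
      { hom := coprod.desc (Limits.Sigma.ι G none ≫ coprod.inr)
          (coprod.map (𝟙 A) (Limits.Sigma.desc fun t => Limits.Sigma.ι G (some t)))
        inv := coprod.desc (coprod.inl ≫ coprod.inr) (Limits.Sigma.desc fun t => match t with
          | none => coprod.inl
          | some t => Limits.Sigma.ι G' t ≫ coprod.inr ≫ coprod.inr)
        hom_inv_id := by
          ext <;> simp [G', coprod.inl_desc, coprod.inr_desc]
        inv_hom_id := by
          ext t
          · simp [coprod.inl_desc, coprod.inr_desc]
          · cases t <;> simp [G', coprod.inl_desc, coprod.inr_desc] }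
    -- Up to the isomorphism `i`, the last summand `G none` is adjoined to `A ⨿ ∐ G'`.
    have fac : (coprod.inl : A ⟶ A ⨿ ∐ G) = (coprod.inl ≫ coprod.inr) ≫ i.hom := by
      simp [i, coprod.inr_desc]
    have : IsIso i.hom := i.isIso_hom
    rw [fac]
    refine (W.cancel_right_of_respectsIso _ _).2 ?_
    exact W.comp_mem _ _ h₁ (hG none _)

/-- The functor sending a finite subset `s` of `T` to `A ⨿ ∐ G`, with the second coproduct over
`s`. -/
noncomputable def finiteCoprod (A : C) {T : Type v} (G : T → C) : Finset T ⥤ C where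
  obj s := A ⨿ ∐ fun t : s => G t
  map {s s'} h := coprod.map (𝟙 A)
    (Limits.Sigma.desc fun t => Limits.Sigma.ι (fun t : s' => G t) ⟨t.1, leOfHom h t.2⟩)
  map_id s := by
    ext
    · simp
    · simp
  map_comp f g := by
    ext <;> simp

/-- The colimit cocone of `finiteCoprod A G`. -/
noncomputable def finiteCoprodCocone (A : C) {T : Type v} (G : T → C) :
    Cocone (finiteCoprod A G) where
  pt := A ⨿ ∐ G
  ι :=
    { app s := coprod.map (𝟙 A) (Limits.Sigma.desc fun t => Limits.Sigma.ι G t)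
      naturality s s' f := by
        dsimp [finiteCoprod]
        ext <;> simp }

/-- The cocone `finiteCoprodCocone A G` is a colimit. -/
noncomputable def finiteCoprodCoconeIsColimit (A : C) {T : Type v} (G : T → C) :
    IsColimit (finiteCoprodCocone A G) where
  -- The summand `A` is already present at stage `∅`, and the summand indexed by `t` at stage `{t}`.
  desc c := coprod.desc (coprod.inl ≫ c.ι.app ∅)
    (Limits.Sigma.desc fun t => Limits.Sigma.ι (fun s : ({t} : Finset T) => G s) ⟨t, by simp⟩ ≫
      coprod.inr ≫ c.ι.app {t})
  fac c s := by
    dsimp [finiteCoprodCocone, finiteCoprod]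
    refine coprod.hom_ext ?_ (Sigma.hom_ext _ _ fun t => ?_)
    · have := c.w (homOfLE (Finset.empty_subset s) : (∅ : Finset T) ⟶ s)
      dsimp [finiteCoprod] at this
      simp [← this, coprod.inl_desc]
    · have := c.w (homOfLE (by simp) : ({t.1} : Finset T) ⟶ s)
      dsimp [finiteCoprod] at this
      simp [← this, coprod.inr_desc]
  uniq c m hm := by
    dsimp [finiteCoprodCocone] at m hm
    refine coprod.hom_ext ?_ (Sigma.hom_ext _ _ fun t => ?_)
    · rw [coprod.inl_desc, ← hm]
      erw [coprod.inl_map_assoc, Category.id_comp]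
    · rw [coprod.inr_desc, Limits.Sigma.ι_desc, ← hm]
      erw [coprod.inr_map_assoc, Limits.Sigma.ι_desc_assoc]

lemma coprod_inl_of_isNegligible [W.IsMultiplicative] [W.RespectsIso]
    [MorphismProperty.IsStableUnderFilteredColimits.{v, v} W] (A : C) {T : Type v} (G : T → C)
    (hG : ∀ t, W.isNegligible (G t)) : W (coprod.inl : A ⟶ A ⨿ ∐ G) := by
  have h (s : Finset T) : W (coprod.inl : A ⟶ (finiteCoprod A G).obj s) :=
    coprod_inl_of_finite A s inferInstance _ fun t => hG t
  -- Connectedness makes `A` the colimit of the constant diagram, so that the inclusions into the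
  -- finite stages have `coprod.inl` as their colimit.
  have := IsFiltered.isConnected (Finset T)
  exact IsStableUnderColimitsOfShape.condition (W := W) _ _ _ _
    (isColimitConstCocone (Finset T) A) (finiteCoprodCoconeIsColimit A G)
    { app s := (coprod.inl : A ⟶ (finiteCoprod A G).obj s)
      naturality s s' f := by simp [finiteCoprod] } h _
    (fun s => (Category.id_comp _).trans (by simp [finiteCoprodCocone, finiteCoprod]))

end

section

variable {C : Type u} [Category.{v} C] [HasColimits C]

attribute [local instance] Cardinal.fact_isRegular_aleph0 Cardinal.orderBotAleph0OrdToType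

/-- Finitely presentable sources suffice, with `ℵ₀` as the cardinal bounding the iteration. -/
lemma hasSmallObjectArgument_ofHoms {ι : Type v} {X Y : ι → C} (f : ∀ i, X i ⟶ Y i)
    (hX : ∀ i, IsFinitelyPresentable.{v} (X i)) : HasSmallObjectArgument.{v} (ofHoms f) :=
  ⟨.aleph0, inferInstance, inferInstance,
    { preservesColimit := by
        rintro _ _ _ _ _ ⟨i⟩ _ _
        have := hX i
        infer_instance }⟩

end

end CategoryTheory.MorphismProperty

/-! ### The model structure on `C` -/

namespace DGModule

section

variable {R : Type v} [Ring R] {𝒜 : ℤ → AddSubgroup R} [GradedRing 𝒜] {S : Type v}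
  {C : Type u} [Category.{v} C] (U : C ⥤ (S → DGModule 𝒜))

lemma weq_iff {X Y : C} (f : X ⟶ Y) : weq U f ↔ ∀ x : S,
    (HomologicalComplex.quasiIso AddCommGrpCat.{v} (ComplexShape.up ℤ)).inverseImage
      (U ⋙ Pi.eval _ x ⋙ toCochainComplex 𝒜) f :=
  Iff.rfl

instance : (weq U).HasTwoOutOfThreeProperty where
  comp_mem f g hf hg := (weq_iff U _).2 fun x =>
    MorphismProperty.comp_mem _ f g ((weq_iff U f).1 hf x) ((weq_iff U g).1 hg x)
  of_postcomp f g hg hfg := (weq_iff U _).2 fun x =>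
    MorphismProperty.of_postcomp _ f g ((weq_iff U g).1 hg x) ((weq_iff U _).1 hfg x)
  of_precomp f g hf hfg := (weq_iff U _).2 fun x =>
    MorphismProperty.of_precomp _ f g ((weq_iff U f).1 hf x) ((weq_iff U _).1 hfg x)

instance : (weq U).IsMultiplicative where
  id_mem X := (weq_iff U _).2 fun _ => MorphismProperty.id_mem _ X

instance : (weq U).IsStableUnderRetracts where
  of_retract h hg := (weq_iff U _).2 fun x =>
    MorphismProperty.of_retract (P := HomologicalComplex.quasiIso _ _)
      (h.map (U ⋙ Pi.eval _ x ⋙ toCochainComplex 𝒜)) ((weq_iff U _).1 hg x)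

instance [PreservesFilteredColimitsOfSize.{v, v} U] :
    MorphismProperty.IsStableUnderFilteredColimits.{v, v} (weq U) where
  isStableUnderColimitsOfShape J _ _ :=
    { condition X₁ X₂ c₁ c₂ h₁ h₂ f hf φ hφ :=
        isQuasiIsoPi_of_isColimit (isColimitOfPreserves U h₁) (isColimitOfPreserves U h₂)
          (Functor.whiskerRight f U) hf (U.map φ) (fun j => by
            dsimp
            rw [← U.map_comp, hφ, U.map_comp]) }

section

variable {U} {F : (S → DGModule 𝒜) ⥤ C} (adj : F ⊣ U)
include adj

lemma rlp_map_acyclicGenerators :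
    (MorphismProperty.ofHoms fun e => F.map (acyclicGenerators 𝒜 S e)).rlp = fib U := by
  ext X Y f
  refine Iff.trans ?_ (hasLiftingProperty_acyclicGenerators_iff (U.map f))
  constructor
  · exact fun h e => (adj.hasLiftingProperty_iff _ _).1 (h _ ⟨e⟩)
  · rintro h _ _ _ ⟨e⟩
    exact (adj.hasLiftingProperty_iff _ _).2 (h e)

lemma rlp_map_generators :
    (MorphismProperty.ofHoms fun e => F.map (generators 𝒜 S e)).rlp = fib U ⊓ weq U := by
  ext X Y f
  refine Iff.trans ?_ (hasLiftingProperty_generators_iff (U.map f))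
  constructor
  · exact fun h e => (adj.hasLiftingProperty_iff _ _).1 (h _ ⟨e⟩)
  · rintro h _ _ _ ⟨e⟩
    exact (adj.hasLiftingProperty_iff _ _).2 (h e)

attribute [local instance] Cardinal.fact_isRegular_aleph0

/-- Maps from `F M` to `Y` are maps from `M` to `U Y`, and `U` preserves filtered colimits. -/
lemma isFinitelyPresentable_leftAdjoint_obj [PreservesFilteredColimitsOfSize.{v, v} U]
    (M : S → DGModule 𝒜) [IsFinitelyPresentable.{v} M] : IsFinitelyPresentable.{v} (F.obj M) := by
  have : U.IsFinitelyAccessible :=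
    Functor.IsFinitelyAccessible_iff_preservesFilteredColimitsOfSize.2 inferInstance
  exact adj.isCardinalPresentable_leftAdjoint_obj _ M

/-- This factorization serves only to prove acyclicity: its first map is a weak equivalence by the
hypothesis on `K_x[p]`, which is not yet known for the factorization from the small object argument.
-/
lemma exists_fac_weq_fib [HasColimits C] [PreservesFilteredColimitsOfSize.{v, v} U]
    (hK : ∀ (A : C) (x : S) (p : ℤ),
      IsQuasiIsoPi (U.map (coprod.inr : A ⟶ F.obj (shiftPi (coneAt 𝒜 x) p) ⨿ A)))
    {A B : C} (f : A ⟶ B) :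
    ∃ (Z : C) (i : A ⟶ Z) (p : Z ⟶ B), weq U i ∧ fib U p ∧ i ≫ p = f := by
  have gen (x : S) (n : ℤ) (y : (U.obj B x).X n) :
      ∃ (κ : (shiftPi (coneAt 𝒜 x) (- n - 1) x).X n)
        (φ : F.obj (shiftPi (coneAt 𝒜 x) (- n - 1)) ⟶ B),
        Hom.f (adj.homEquiv _ _ φ x) n κ = y := by
    obtain ⟨κ, hκ⟩ := exists_isUniversalElement (𝒜 := 𝒜) x (n := n) (p := - n - 1) (by omega)
    obtain ⟨ψ, hψ, -⟩ := hκ (U.obj B) y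
    exact ⟨κ, (adj.homEquiv _ _).symm ψ, by rw [Equiv.apply_symm_apply, hψ]⟩
  choose κ φ hφ using gen
  -- One summand for each element of `U B`, so that every element is hit; `T` is small enough for
  -- the coproduct to exist.
  let T : Type v := Σ (x : S) (n : ℤ), (U.obj B x).X n
  let G (t : T) : C := F.obj (shiftPi (coneAt 𝒜 t.1) (- t.2.1 - 1))
  let p : A ⨿ ∐ G ⟶ B := coprod.desc f (Limits.Sigma.desc fun t => φ t.1 t.2.1 t.2.2)
  refine ⟨A ⨿ ∐ G, coprod.inl, p, ?_, ?_, coprod.inl_desc _ _⟩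
  · exact MorphismProperty.coprod_inl_of_isNegligible A G fun t A => hK A _ _
  · intro x n y
    let j : G ⟨x, n, y⟩ ⟶ A ⨿ ∐ G := Limits.Sigma.ι G ⟨x, n, y⟩ ≫ coprod.inr
    have hj : j ≫ p = φ x n y := by
      simp [j, p, coprod.inr_desc]
    refine ⟨Hom.f (adj.homEquiv _ _ j x) n (κ x n y), ?_⟩
    rw [← f_comp_apply, ← adj.homEquiv_naturality_right, hj, hφ]

/-- Retract argument: lifting `f` against the fibration `p` exhibits `f` as a retract of the weak
equivalence `i`. -/
lemma llp_fib_le_weq [HasColimits C] [PreservesFilteredColimitsOfSize.{v, v} U]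
    (hK : ∀ (A : C) (x : S) (p : ℤ),
      IsQuasiIsoPi (U.map (coprod.inr : A ⟶ F.obj (shiftPi (coneAt 𝒜 x) p) ⨿ A))) :
    (fib U).llp ≤ weq U := by
  intro A B f hf
  obtain ⟨Z, i, p, hi, hp, fac⟩ := exists_fac_weq_fib adj hK f
  have := hf p hp
  exact MorphismProperty.of_retract (RetractArrow.ofLeftLiftingProperty fac) hi

lemma exists_modelCategory [HasLimits C] [HasColimits C]
    [PreservesFilteredColimitsOfSize.{v, v} U]
    (hK : ∀ (A : C) (x : S) (p : ℤ),
      IsQuasiIsoPi (U.map (coprod.inr : A ⟶ F.obj (shiftPi (coneAt 𝒜 x) p) ⨿ A))) :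
    ∃ _ : ModelCategory C,
      weakEquivalences C = weq U ∧ fibrations C = fib U ∧ cofibrations C = cof U ∧
      (trivialCofibrations C).HasFunctorialFactorization (fibrations C) ∧
      (cofibrations C).HasFunctorialFactorization (trivialFibrations C) := by
  have facJ : (fib U).llp.HasFunctorialFactorization (fib U) := by
    have := MorphismProperty.hasSmallObjectArgument_ofHoms
      (fun e => F.map (acyclicGenerators 𝒜 S e))
      (fun _ => isFinitelyPresentable_leftAdjoint_obj adj _)
    rw [← rlp_map_acyclicGenerators adj]
    infer_instance
  have facI : (cof U).HasFunctorialFactorization (fib U ⊓ weq U) := by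
    have := MorphismProperty.hasSmallObjectArgument_ofHoms
      (fun e => F.map (generators 𝒜 S e))
      (fun _ => isFinitelyPresentable_leftAdjoint_obj adj _)
    rw [cof, ← rlp_map_generators adj]
    infer_instance
  -- For the nontrivial inclusion, factor `f` with a first map in `(fib U).llp`. Acyclicity and
  -- two-out-of-three make the second map a trivial fibration, so `f` lifts against it and is a
  -- retract of the first map.
  have triv : cof U ⊓ weq U = (fib U).llp := by
    refine le_antisymm ?_ (le_inf (MorphismProperty.antitone_llp inf_le_left)
      (llp_fib_le_weq adj hK))
    rintro A B f ⟨hf, hf'⟩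
    have h := MorphismProperty.factorizationData (fib U).llp (fib U) f
    have hp : weq U h.p := MorphismProperty.of_precomp _ h.i h.p
      (llp_fib_le_weq adj hK _ h.hi) (by rwa [h.fac])
    have := hf h.p ⟨h.hp, hp⟩
    exact MorphismProperty.of_retract (RetractArrow.ofLeftLiftingProperty h.fac) h.hi
  let _ : CategoryWithFibrations C := ⟨fib U⟩
  let _ : CategoryWithCofibrations C := ⟨cof U⟩
  let _ : CategoryWithWeakEquivalences C := ⟨weq U⟩
  have hfib : fibrations C = fib U := rfl
  have hcof : cofibrations C = cof U := rfl
  have hweq : weakEquivalences C = weq U := rfl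
  have facJ' : (trivialCofibrations C).HasFunctorialFactorization (fibrations C) := by
    rw [trivialCofibrations, hcof, hweq, triv]
    exact facJ
  have facI' : (cofibrations C).HasFunctorialFactorization (trivialFibrations C) := facI
  refine ⟨{ cm2 := ?_, cm3a := ?_, cm3b := ?_, cm3c := ?_, cm4a := ?_, cm4b := ?_ },
    rfl, rfl, rfl, facJ', facI'⟩
  · rw [hweq]
    infer_instance
  · rw [hweq]
    infer_instance
  · rw [hfib, ← rlp_map_acyclicGenerators adj]
    infer_instance
  · rw [hcof, cof]
    infer_instance
  · intro A B X Y i p hi hi' hp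
    have : (cof U ⊓ weq U) i := ⟨hi.mem, hi'.mem⟩
    rw [triv] at this
    exact this p hp.mem
  · intro A B X Y i p hi hp hp'
    exact hi.mem p ⟨hp.mem, hp'.mem⟩

end

end

end DGModule

theorem theorem1 {R : Type v} [Ring R] (𝒜 : ℤ → AddSubgroup R) [GradedRing 𝒜]
    (hcomm : IsGradedCommutative 𝒜) (S : Type v)
    (C : Type u) [Category.{v} C] [HasLimits C] [HasColimits C]
    (F : (S → DGModule 𝒜) ⥤ C) (U : C ⥤ (S → DGModule 𝒜)) (adj : F ⊣ U)
    [PreservesFilteredColimitsOfSize.{v, v} U]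
    (hK : ∀ (A : C) (x : S) (p : ℤ),
      DGModule.IsQuasiIsoPi (U.map
        (coprod.inr : A ⟶ F.obj (DGModule.shiftPi (DGModule.coneAt 𝒜 x) p) ⨿ A))) :
    ∃ _ : ModelCategory C,
      weakEquivalences C = DGModule.weq U ∧
      fibrations C = DGModule.fib U ∧
      cofibrations C = DGModule.cof U ∧
      (trivialCofibrations C).HasFunctorialFactorization (fibrations C) ∧
      (cofibrations C).HasFunctorialFactorization (trivialFibrations C) := by
  obtain ⟨_, h₁, h₂, h₃, h₄, h₅⟩ := DGModule.exists_modelCategory adj hK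
  exact ⟨_, h₁, h₂, h₃, h₄, h₅⟩
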